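/- Let $\Gamma$ be a Bieberbach group of dimension $n$, i.e. a discrete, cocompact group of isometries of Euclidean space $E^n$ acting without fixed points (every $\gamma\in\Gamma\setminus\{1\}$ has no fixed point), and let $M=E^n/\Gamma$ be the corresponding Bieberbach manifold with its flat metric. Let $\Lambda=\{v\in\mathbb{R}^n : t_v\in\Gamma\}$, where $t_v(x)=x+v$, and let the holonomy group $G\cong\Gamma/\Lambda$ be realized as the group of linear parts of the elements of $\Gamma$ in $O(n)$. Suppose that $G\cong\mathbb{Z}/2\mathbb{Z}$, and let $P\subset\mathbb{R}^n$ be the linear subspace of vectors fixed by $G$. Then: 1. There is a vector $v\in\tfrac12\Lambda\setminus\Lambda$ orthogonal to $P$. 2. For every $v\in\tfrac12\Lambda\setminus\Lambda$ orthogonal to $P$, the translation $t_v$ induces a map $M\to M$ which is a fixed-point-free isometric involution. 3. $M$ is the totally geodesic boundary of a compact flat $(n+1)$-manifold: there is a compact connected smooth $(n+1)$-manifold $W$ with boundary, carrying a smooth Riemannian metric which is flat (every point has a neighbourhood that embeds isometrically in $E^{n+1}$) and for which $\partial W$ is totally geodesic, such that $\partial W$ with its induced metric is isometric to $M$. -/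

import Mathlib

open scoped Manifold ContDiff Topology

noncomputable section

namespace FlatBoundary

/-- Euclidean `n`-space. -/
abbrev Euc (n : ℕ) : Type := EuclideanSpace ℝ (Fin n)

/-- The group of isometries of Euclidean `n`-space. -/
abbrev Isom (n : ℕ) : Type := Euc n ≃ᵃⁱ[ℝ] Euc n

/-- Isometries act on Euclidean space by evaluation. -/
instance instIsomAction (n : ℕ) : MulAction (Isom n) (Euc n) where
  smul γ x := γ x
  one_smul _ := rfl
  mul_smul _ _ _ := rfl

theorem isom_smul_def {n : ℕ} (γ : Isom n) (x : Euc n) : γ • x = γ x := rfl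

/-- The homomorphism sending an isometry `x ↦ A x + b` to its linear part `A ∈ O(n)`. -/
def linearPart (n : ℕ) : Isom n →* (Euc n ≃ₗᵢ[ℝ] Euc n) where
  toFun γ := γ.linearIsometryEquiv
  map_one' := by ext; rfl
  map_mul' _ _ := by ext; rfl

/-- The orbit space `Eⁿ / Γ`, with the quotient topology. -/
abbrev OrbitSpace {n : ℕ} (Γ : Subgroup (Isom n)) : Type :=
  MulAction.orbitRel.Quotient Γ (Euc n)

/-- The projection `Eⁿ → Eⁿ / Γ`. -/
def proj {n : ℕ} (Γ : Subgroup (Isom n)) (x : Euc n) : OrbitSpace Γ :=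
  Quotient.mk _ x

/-- Bieberbach groups: discrete, cocompact groups of isometries of `Eⁿ` acting without fixed
points. (On the isometry group, the topology of pointwise convergence is the usual one.) -/
structure IsBieberbach {n : ℕ} (Γ : Subgroup (Isom n)) : Prop where
  discrete : IsDiscrete ((fun (γ : Isom n) (x : Euc n) => γ x) '' (Γ : Set (Isom n)))
  cocompact : CompactSpace (OrbitSpace Γ)
  free : ∀ γ ∈ Γ, γ ≠ 1 → ∀ x : Euc n, γ x ≠ x

/-- The translation by the vector `v`. -/
def trans {n : ℕ} (v : Euc n) : Isom n := AffineIsometryEquiv.constVAdd ℝ (Euc n) v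

theorem trans_apply {n : ℕ} (v x : Euc n) : trans v x = v + x := rfl

/-- The group `Λ` of all vectors `v` such that the translation by `v` belongs to `Γ`. -/
def translationLattice {n : ℕ} (Γ : Subgroup (Isom n)) : AddSubgroup (Euc n) where
  carrier := {v | trans v ∈ Γ}
  zero_mem' := by
    have h : trans (0 : Euc n) = 1 := by ext1 x; simp [trans_apply]
    simp [h, Γ.one_mem]
  add_mem' {a b} ha hb := by
    have h : trans (a + b) = trans a * trans b := by
      ext1 x; simp [trans_apply, AffineIsometryEquiv.coe_mul, add_assoc]
    simpa [h] using Γ.mul_mem ha hb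
  neg_mem' {a} ha := by
    have h : trans (-a) = (trans a)⁻¹ := by
      rw [eq_inv_iff_mul_eq_one]
      ext1 x; simp [trans_apply, AffineIsometryEquiv.coe_mul]
    simpa [h] using Γ.inv_mem ha

/-- The holonomy group of `Eⁿ / Γ`: the group `Γ / Λ` in its natural realization as a subgroup of
`O(n)`, i.e. the group of linear parts of elements of `Γ`. -/
def holonomyGroup {n : ℕ} (Γ : Subgroup (Isom n)) : Subgroup (Euc n ≃ₗᵢ[ℝ] Euc n) :=
  Γ.map (linearPart n)

/-- The distance of the flat metric on `Eⁿ / Γ`: the distance between the two orbits. -/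
def orbitDist {n : ℕ} (Γ : Subgroup (Isom n)) (a b : OrbitSpace Γ) : ℝ :=
  sInf {r | ∃ x y : Euc n, proj Γ x = a ∧ proj Γ y = b ∧ r = dist x y}

/-- Fixed-point-free isometric involutions of `Eⁿ / Γ`. -/
structure IsAdmissible {n : ℕ} (Γ : Subgroup (Isom n)) (f : OrbitSpace Γ → OrbitSpace Γ) :
    Prop where
  isometric : ∀ a b, orbitDist Γ (f a) (f b) = orbitDist Γ a b
  involutive : Function.Involutive f
  fixedPointFree : ∀ a, f a ≠ a

/-- Vectors `v ∈ ½Λ ∖ Λ` that are orthogonal to the subspace fixed by the holonomy group. -/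
structure IsHalfLatticeVector {n : ℕ} (Γ : Subgroup (Isom n)) (v : Euc n) : Prop where
  two_smul_mem : (2 : ℝ) • v ∈ translationLattice Γ
  notMem : v ∉ translationLattice Γ
  orthogonal : ∀ w : Euc n, (∀ A ∈ holonomyGroup Γ, A w = w) → inner ℝ v w = 0

section Riemannian

variable {m : ℕ} [NeZero m] {W : Type} [TopologicalSpace W]
  [ChartedSpace (EuclideanHalfSpace m) W] [IsManifold (𝓡∂ m) ∞ W]

/-- Smooth Riemannian metrics on a smooth `m`-manifold with boundary. -/
abbrev Metric (m : ℕ) [NeZero m] (W : Type) [TopologicalSpace W]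
    [ChartedSpace (EuclideanHalfSpace m) W] [IsManifold (𝓡∂ m) ∞ W] : Type :=
  Bundle.ContMDiffRiemannianMetric (𝓡∂ m) ∞ (Euc m) (fun p : W => TangentSpace (𝓡∂ m) p)

/-- A Riemannian metric is flat if it is locally isometric to Euclidean space: every point has an
open neighbourhood `U` with a smooth injective map to `Eᵐ` that preserves the inner products of
tangent vectors. (At a boundary point `U` is a neighbourhood in the manifold with boundary.) -/
def IsFlat (g : Metric m W) : Prop :=
  ∀ p : W, ∃ (U : Set W) (f : W → Euc m), IsOpen U ∧ p ∈ U ∧ Set.InjOn f U ∧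
    ContMDiffOn (𝓡∂ m) 𝓘(ℝ, Euc m) ∞ f U ∧
    ∀ q ∈ U, ∀ u v : TangentSpace (𝓡∂ m) q,
      @inner ℝ (Euc m) _ (mfderiv (𝓡∂ m) 𝓘(ℝ, Euc m) f q u) (mfderiv (𝓡∂ m) 𝓘(ℝ, Euc m) f q v) =
        g.inner q u v

/-- The metric read in the preferred chart at `p`: the inner product at the point with
coordinates `y` of the coordinate vector fields with constant components `u` and `v`. -/
def coordMetric (g : Metric m W) (p : W) (y u v : Euc m) : ℝ :=
  g.inner ((extChartAt (𝓡∂ m) p).symm y)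
    (mfderivWithin 𝓘(ℝ, Euc m) (𝓡∂ m) (extChartAt (𝓡∂ m) p).symm (Set.range (𝓡∂ m)) y u)
    (mfderivWithin 𝓘(ℝ, Euc m) (𝓡∂ m) (extChartAt (𝓡∂ m) p).symm (Set.range (𝓡∂ m)) y v)

/-- `2 g(∇_u v, w)` at `p` for the Levi-Civita connection `∇` and the vector fields `u`, `v`, `w`
with constant components in the preferred chart at `p`, by the Koszul formula
`∂_u g(v, w) + ∂_v g(u, w) - ∂_w g(u, v)`. -/
def koszul (g : Metric m W) (p : W) (u v w : Euc m) : ℝ :=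
  fderivWithin ℝ (fun y => coordMetric g p y v w) (Set.range (𝓡∂ m)) (extChartAt (𝓡∂ m) p p) u +
  fderivWithin ℝ (fun y => coordMetric g p y u w) (Set.range (𝓡∂ m)) (extChartAt (𝓡∂ m) p p) v -
  fderivWithin ℝ (fun y => coordMetric g p y u v) (Set.range (𝓡∂ m)) (extChartAt (𝓡∂ m) p p) w

/-- The boundary is totally geodesic if its second fundamental form vanishes: at each boundary
point, `g(∇_u v, w) = 0` for `u`, `v` tangent to the boundary (that is, with vanishing `0`-th
component) and `w` normal to the boundary. -/
def HasTotallyGeodesicBoundary (g : Metric m W) : Prop :=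
  ∀ p ∈ (𝓡∂ m).boundary W, ∀ u v w : Euc m, u 0 = 0 → v 0 = 0 →
    (∀ z : Euc m, z 0 = 0 → coordMetric g p (extChartAt (𝓡∂ m) p p) w z = 0) →
    koszul g p u v w = 0

/-- A homeomorphism `φ` from `Eⁿ / Γ` onto the boundary of a Riemannian manifold is an isometry
(for the flat metric of `Eⁿ / Γ` and the metric induced on the boundary) if its composition with
the locally isometric projection `Eⁿ → Eⁿ / Γ` is smooth and preserves the inner products of
tangent vectors. -/
def IsIsometryOntoBoundary {n : ℕ} (Γ : Subgroup (Isom n)) (g : Metric m W)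
    (φ : OrbitSpace Γ ≃ₜ (𝓡∂ m).boundary W) : Prop :=
  ContMDiff 𝓘(ℝ, Euc n) (𝓡∂ m) ∞ (fun x : Euc n => (φ (proj Γ x) : W)) ∧
  ∀ x u v : Euc n,
    g.inner (φ (proj Γ x) : W)
      (mfderiv 𝓘(ℝ, Euc n) (𝓡∂ m) (fun x : Euc n => (φ (proj Γ x) : W)) x u)
      (mfderiv 𝓘(ℝ, Euc n) (𝓡∂ m) (fun x : Euc n => (φ (proj Γ x) : W)) x v) = inner ℝ u v

end Riemannian

/-- `Eⁿ / Γ` is (isometric to) the totally geodesic boundary of a compact connected flat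
Riemannian `(n+1)`-manifold. (Second countability of `W` follows from compactness.) -/
def IsGeodesicBoundary {n : ℕ} (Γ : Subgroup (Isom n)) : Prop :=
  ∃ (W : Type) (_ : TopologicalSpace W) (_ : ChartedSpace (EuclideanHalfSpace (n + 1)) W)
    (_ : IsManifold (𝓡∂ (n + 1)) ∞ W) (g : Metric (n + 1) W),
    T2Space W ∧ CompactSpace W ∧ ConnectedSpace W ∧
    IsFlat g ∧ HasTotallyGeodesicBoundary g ∧
    ∃ φ : OrbitSpace Γ ≃ₜ (𝓡∂ (n + 1)).boundary W, IsIsometryOntoBoundary Γ g φ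

end FlatBoundary

end

/-!
Let `A` be the nontrivial element of the holonomy group, so `A² = 1`, and let `Λ` be the lattice of
translations.

*Existence of the half-lattice vector.* If `A` fixed `Λ` pointwise, then, up to a translation, the
distance to the fixed space of `A` would be `Γ`-invariant, hence a bounded function on `Eⁿ`, as the
quotient is compact; but it is unbounded. So there is `w ∈ Λ` with `u = w - A w ≠ 0`. Now `u` lies
in `Λ` and in the `-1`-eigenspace of `A`, which is the orthogonal complement of the fixed space of
the holonomy. Since `Λ` is discrete, `u` cannot be halved indefinitely inside `Λ`, and the first
failure gives the vector (`IsHolonomyInvolution.exists_isHalfLatticeVector`).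

*The involution.* If `A v = -v` and `2v ∈ Λ`, then conjugation by the translation `τ` by `v`
changes the elements of `Γ` with linear part `A` by the translation by `2v` and fixes the others,
so `τ` normalizes `Γ` and `τ² ∈ Γ`. If `τ x = γ x` with `γ ∈ Γ`, then either `γ` is a translation
and `v ∈ Λ`, or the translation part of `γ` lies in the `-1`-eigenspace of `A` and `γ` has a fixed
point (`IsHalfLatticeVector.inducesFreeInvolution`).

*The bounding manifold.* The group `Δ` generated by `Γ` and `τ` contains `Γ` with index two. It
acts on the slab `Eⁿ × [-1, 1]`, where elements outside `Γ` also reflect the interval. This action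
is free and properly discontinuous, so the quotient `W` is a compact Hausdorff flat manifold. Its
boundary is `Eⁿ × {±1}` modulo `Δ`, which is `Eⁿ × {1}` modulo `Γ`
(`InducesFreeInvolution.isGeodesicBoundary`).

For the smooth structure, every point of `W` has a representative in `Eⁿ × (-1, 1]`, which is an
open piece of a half-space; hence the local inverses of the projection from this piece to `W` form
an atlas. Its coordinate changes are locally Euclidean isometries
(`IsEuclideanParametrization.hasEuclideanCharts`). A tangent space in Mathlib is identified with
the model space through the preferred chart, so the flat metric is just the inner product of the
model space at every point, and its coefficients in any preferred chart are constant
(`HasEuclideanCharts.coordMetric_eq`). Flatness and the vanishing of the Koszul expression, hence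
of the second fundamental form, follow at once.
-/

noncomputable section

namespace FlatBoundary

/-! ### Bieberbach groups -/

section Bieberbach

variable {n : ℕ} {Γ : Subgroup (Isom n)}

theorem isom_apply_eq (γ : Isom n) (x : Euc n) : γ x = linearPart n γ x + γ 0 := by
  exact (congrArg γ (add_zero x).symm).trans (γ.map_vadd 0 x)

theorem eq_trans_of_linearPart_eq_one {γ : Isom n} (h : linearPart n γ = 1) :
    γ = trans (γ 0) := by
  ext1 x
  rw [isom_apply_eq, h, trans_apply, add_comm]
  rfl

theorem proj_eq_proj_iff {x y : Euc n} : proj Γ x = proj Γ y ↔ ∃ γ ∈ Γ, γ y = x := by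
  rw [proj, proj, Quotient.eq, MulAction.orbitRel_apply, MulAction.mem_orbit_iff]
  exact ⟨fun ⟨γ, h⟩ => ⟨γ, γ.2, h⟩, fun ⟨γ, h, h'⟩ => ⟨⟨γ, h⟩, h'⟩⟩

theorem proj_surjective : Function.Surjective (proj Γ) := Quotient.mk_surjective

/-- A quantitative form of discreteness at the identity: an element of `Γ` that moves each of
finitely many suitable points by less than a suitable `ε` is trivial. -/
theorem IsBieberbach.exists_finset_forall_dist_lt (hΓ : IsBieberbach Γ) :
    ∃ F : Finset (Euc n), ∃ ε > 0, ∀ γ ∈ Γ, (∀ x ∈ F, dist (γ x) x < ε) → γ = 1 := by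
  obtain ⟨u, hu, hu'⟩ := isDiscrete_iff_forall_mem_exists_isOpen.1 hΓ.discrete
    (fun x => (1 : Isom n) x) ⟨1, Γ.one_mem, rfl⟩
  have hmem : (fun x => (1 : Isom n) x) ∈ u := by
    have : (fun x => (1 : Isom n) x) ∈ u ∩ (fun (γ : Isom n) (x : Euc n) => γ x) '' Γ := by
      rw [hu']; rfl
    exact this.1
  obtain ⟨F, v, hv, hsub⟩ := isOpen_pi_iff.1 hu _ hmem
  have hε : ∀ x ∈ F, ∀ᶠ ε in 𝓝[>] (0 : ℝ), Metric.ball x ε ⊆ v x := by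
    intro x hx
    obtain ⟨ε, hε, h⟩ := Metric.isOpen_iff.1 (hv x hx).1 _ (hv x hx).2
    filter_upwards [Ioo_mem_nhdsGT hε] with δ hδ
    exact (Metric.ball_subset_ball hδ.2.le).trans h
  have := ((Filter.eventually_all_finset F).2 hε).and self_mem_nhdsWithin
  obtain ⟨ε, hε, hpos⟩ := this.exists
  refine ⟨F, ε, hpos, fun γ hγ h => ?_⟩
  have : (fun x => γ x) ∈ u ∩ (fun (γ : Isom n) (x : Euc n) => γ x) '' Γ :=
    ⟨hsub fun x hx => hε x hx (h x hx), γ, hγ, rfl⟩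
  rw [hu'] at this
  ext1 x
  exact congrFun this x

theorem IsBieberbach.exists_eps_translationLattice (hΓ : IsBieberbach Γ) :
    ∃ ε > 0, ∀ v ∈ translationLattice Γ, ‖v‖ < ε → v = 0 := by
  obtain ⟨F, ε, hε, h⟩ := hΓ.exists_finset_forall_dist_lt
  refine ⟨ε, hε, fun v hv hlt => ?_⟩
  have := h (trans v) hv fun x _ => by simpa [trans_apply, dist_eq_norm] using hlt
  simpa [trans_apply] using congrArg (fun γ : Isom n => γ 0) this

/-- Proper discontinuity on a coset of a Bieberbach group: only finitely many elements of it move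
a bounded set so as to meet another one. On such elements, evaluation at a suitable finite set
has bounded and uniformly separated values. -/
theorem IsBieberbach.finite_inter (hΓ : IsBieberbach Γ) (τ : Isom n) {K L : Set (Euc n)}
    (hK : Bornology.IsBounded K) (hL : Bornology.IsBounded L) :
    {δ : Isom n | τ * δ ∈ Γ ∧ ∃ x ∈ K, δ x ∈ L}.Finite := by
  obtain ⟨F, ε, hε, hF⟩ := hΓ.exists_finset_forall_dist_lt
  obtain ⟨R, hR⟩ := (hK.union (hL.union F.finite_toSet.isBounded)).subset_closedBall 0
  set C := {δ : Isom n | τ * δ ∈ Γ ∧ ∃ x ∈ K, δ x ∈ L}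
  let ev : Isom n → (F → Euc n) := fun δ x => δ x
  have hbdd : Bornology.IsBounded (ev '' C) := by
    refine (Metric.isBounded_closedBall (x := (0 : F → Euc n)) (r := 3 * R)).subset ?_
    rintro _ ⟨δ, ⟨-, y, hy, hδ⟩, rfl⟩
    have h1 := mem_closedBall_zero_iff.1 (hR (Or.inl hy))
    have h2 := mem_closedBall_zero_iff.1 (hR (Or.inr (Or.inl hδ)))
    rw [mem_closedBall_zero_iff, pi_norm_le_iff_of_nonneg
      (by linarith [norm_nonneg y])]
    intro x
    have h3 := mem_closedBall_zero_iff.1 (hR (Or.inr (Or.inr x.2)))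
    have h4 : ‖δ x - δ y‖ = ‖(x : Euc n) - y‖ := by
      rw [← dist_eq_norm, δ.dist_map, dist_eq_norm]
    calc ‖δ x‖ = ‖(δ x - δ y) + δ y‖ := by simp
      _ ≤ ‖δ x - δ y‖ + ‖δ y‖ := norm_add_le _ _
      _ ≤ ‖(x : Euc n)‖ + ‖y‖ + ‖δ y‖ := by rw [h4]; gcongr; exact norm_sub_le _ _
      _ ≤ 3 * R := by linarith
  have hsep : ∀ δ ∈ C, ∀ δ' ∈ C, dist (ev δ) (ev δ') < ε → δ = δ' := by
    intro δ hδ δ' hδ' hd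
    have h1 : δ'⁻¹ * δ ∈ Γ := by
      have := Γ.mul_mem (Γ.inv_mem hδ'.1) hδ.1
      simpa [mul_assoc] using this
    have := hF _ h1 fun x hx => ?_
    · exact (inv_mul_eq_one.1 this).symm
    · have h2 : dist ((δ'⁻¹ * δ) x) x = dist (δ x) (δ' x) := by
        rw [← δ'.dist_map]
        congr 1
        exact δ'.apply_symm_apply _
      rw [h2]
      exact (dist_le_pi_dist (ev δ) (ev δ') ⟨x, hx⟩).trans_lt hd
  obtain ⟨t, ht, hcov⟩ := Metric.totallyBounded_iff.1
    (hbdd.isCompact_closure.totallyBounded.subset subset_closure) (ε / 2) (half_pos hε)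
  have hch : ∀ δ : C, ∃ y ∈ t, ev δ ∈ Metric.ball y (ε / 2) := fun δ => by
    simpa using hcov ⟨δ, δ.2, rfl⟩
  choose c hct hc using hch
  have : Finite t := ht
  refine Set.finite_coe_iff.1 (Finite.of_injective (fun δ : C => (⟨c δ, hct δ⟩ : t))
    fun δ δ' h => ?_)
  have h' : c δ = c δ' := congrArg Subtype.val h
  refine Subtype.ext (hsep _ δ.2 _ δ'.2 ?_)
  have h1 := hc δ
  have h2 := hc δ'
  rw [← h', Metric.mem_ball] at h2
  rw [Metric.mem_ball] at h1
  linarith [dist_triangle_right (ev δ) (ev δ') (c δ)]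

end Bieberbach

/-! ### Holonomy of order two -/

section Holonomy

variable {n : ℕ} {Γ : Subgroup (Isom n)}

/-- The data carried by a holonomy group of order two: its nontrivial element `A`. -/
structure IsHolonomyInvolution (Γ : Subgroup (Isom n)) (A : Euc n ≃ₗᵢ[ℝ] Euc n) : Prop where
  ne_one : A ≠ 1
  apply_apply : ∀ x, A (A x) = x
  mem : A ∈ holonomyGroup Γ
  eq_or_eq : ∀ B ∈ holonomyGroup Γ, B = 1 ∨ B = A

theorem exists_isHolonomyInvolution
    (hol : Nonempty (holonomyGroup Γ ≃* Multiplicative (ZMod 2))) :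
    ∃ A, IsHolonomyInvolution Γ A := by
  obtain ⟨e⟩ := hol
  have hdich : ∀ a : Multiplicative (ZMod 2), a = 1 ∨ a = Multiplicative.ofAdd 1 := by decide
  have hsq : (Multiplicative.ofAdd (1 : ZMod 2)) * Multiplicative.ofAdd 1 = 1 := by decide
  have hne : (Multiplicative.ofAdd (1 : ZMod 2)) ≠ 1 := by decide
  set A := e.symm (Multiplicative.ofAdd 1)
  refine ⟨A, fun h => ?_, fun x => ?_, A.2, fun B hB => ?_⟩
  · exact hne (by simpa [A] using congrArg e (Subtype.ext h : A = 1))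
  · have h : A * A = 1 := by rw [← map_mul, hsq, map_one]
    exact congrArg (fun B : holonomyGroup Γ => (B : Euc n ≃ₗᵢ[ℝ] Euc n) x) h
  · rcases hdich (e ⟨B, hB⟩) with h | h
    · left
      have : (⟨B, hB⟩ : holonomyGroup Γ) = 1 := by simpa using h
      exact congrArg Subtype.val this
    · right
      have : (⟨B, hB⟩ : holonomyGroup Γ) = A := (e.symm_apply_eq.2 h.symm).symm
      exact congrArg Subtype.val this

namespace IsHolonomyInvolution

variable {A : Euc n ≃ₗᵢ[ℝ] Euc n} (hA : IsHolonomyInvolution Γ A)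
include hA

theorem exists_linearPart_eq : ∃ γ ∈ Γ, linearPart n γ = A := hA.mem

theorem linearPart_eq {γ : Isom n} (hγ : γ ∈ Γ) : linearPart n γ = 1 ∨ linearPart n γ = A :=
  hA.eq_or_eq _ ⟨γ, hγ, rfl⟩

theorem apply_mem_translationLattice {w : Euc n} (hw : w ∈ translationLattice Γ) :
    A w ∈ translationLattice Γ := by
  obtain ⟨γ, hγ, rfl⟩ := hA.exists_linearPart_eq
  have h : trans (linearPart n γ w) = γ * trans w * γ⁻¹ := by
    rw [eq_mul_inv_iff_mul_eq]
    ext1 x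
    change linearPart n γ w + γ x = γ (w + x)
    rw [isom_apply_eq γ x, isom_apply_eq γ (w + x), map_add, add_assoc]
  change trans (linearPart n γ w) ∈ Γ
  rw [h]
  exact Γ.mul_mem (Γ.mul_mem hγ hw) (Γ.inv_mem hγ)

/-- A vector is orthogonal to the fixed space of the holonomy group if and only if the involution
acts on it by `-1`. -/
theorem forall_inner_eq_zero_iff {v : Euc n} :
    (∀ w : Euc n, (∀ B ∈ holonomyGroup Γ, B w = w) → inner ℝ v w = 0) ↔ A v = -v := by
  constructor
  · intro h
    have hfix : ∀ B ∈ holonomyGroup Γ, B (v + A v) = v + A v := by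
      intro B hB
      rcases hA.eq_or_eq B hB with rfl | rfl
      · rfl
      · rw [map_add, hA.apply_apply, add_comm]
    have h1 := h _ hfix
    have h2 : inner ℝ (A v) (v + A v) = inner ℝ v (v + A v) := by
      rw [← A.inner_map_map v, map_add, hA.apply_apply, add_comm]
    have h3 : inner ℝ (v + A v) (v + A v) = (0 : ℝ) := by
      rw [inner_add_left, h2, h1, add_zero]
    rw [inner_self_eq_zero] at h3
    exact eq_neg_of_add_eq_zero_right h3
  · intro h w hw
    have h1 := A.inner_map_map v w
    rw [h, hw A hA.mem, inner_neg_left] at h1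
    linarith

/-- The translation lattice is not fixed by the holonomy: otherwise the distance to the fixed
space of an element of `Γ` with nontrivial linear part would, up to a translation, be an unbounded
continuous function on the compact orbit space. -/
theorem exists_apply_ne (hΓ : IsBieberbach Γ) : ∃ w ∈ translationLattice Γ, A w ≠ w := by
  by_contra! hfix
  obtain ⟨γ₀, hγ₀, hlin₀⟩ := hA.exists_linearPart_eq
  set b := γ₀ 0
  let h : Euc n → ℝ := fun x => ‖(x - A x) - (1 / 2 : ℝ) • (b - A b)‖
  have hcont : Continuous h := by fun_prop
  have hinv : ∀ γ ∈ Γ, ∀ x, h (γ x) = h x := by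
    intro γ hγ x
    rcases hA.linearPart_eq hγ with hlin | hlin
    · have hγ' := eq_trans_of_linearPart_eq_one hlin
      have hmem : γ 0 ∈ translationLattice Γ := by
        change trans (γ 0) ∈ Γ
        rwa [← hγ']
      have h1 : γ x = x + γ 0 := by rw [isom_apply_eq, hlin]; rfl
      simp only [h, h1, map_add, hfix _ hmem]
      congr 1
      abel
    · have hlin' : linearPart n (γ * γ₀⁻¹) = 1 := by
        rw [map_mul, map_inv, hlin, hlin₀, mul_inv_cancel]
      have hγ' := eq_trans_of_linearPart_eq_one hlin'
      set c := (γ * γ₀⁻¹) 0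
      have hmem : c ∈ translationLattice Γ := by
        change trans c ∈ Γ
        rw [← hγ']
        exact Γ.mul_mem hγ (Γ.inv_mem hγ₀)
      have h1 : γ x = A x + b + c := by
        have h2 : γ = trans c * γ₀ := by rw [← hγ']; simp
        rw [h2]
        change c + γ₀ x = _
        rw [isom_apply_eq γ₀, hlin₀, add_comm]
      simp only [h, h1, map_add, hfix _ hmem, hA.apply_apply]
      rw [← norm_neg]
      congr 1
      module
  have := hΓ.cocompact
  let q : OrbitSpace Γ → ℝ := Quotient.lift h fun x y hxy => by
    obtain ⟨γ, hγ⟩ := hxy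
    rw [← hγ]
    exact hinv γ γ.2 y
  have hq : Continuous q := hcont.quotient_lift _
  obtain ⟨C, hC⟩ := (isCompact_range hq).bddAbove
  have hbound : ∀ x, h x ≤ C := fun x => hC ⟨proj Γ x, rfl⟩
  obtain ⟨u, hu⟩ : ∃ u, A u ≠ u := by
    by_contra! hall
    exact hA.ne_one (LinearIsometryEquiv.ext hall)
  have hpos : 0 < ‖u - A u‖ := norm_pos_iff.2 (sub_ne_zero.2 hu.symm)
  set k := ‖(1 / 2 : ℝ) • (b - A b)‖
  set t : ℝ := (C + k + 1) / ‖u - A u‖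
  have h1 := hbound (t • u)
  have h2 : t * ‖u - A u‖ = C + k + 1 := div_mul_cancel₀ _ hpos.ne'
  have h3 : C + k + 1 ≤ ‖t • (u - A u)‖ := by
    rw [norm_smul, ← h2]
    gcongr
    exact le_abs_self t
  have h4 : ‖t • (u - A u)‖ ≤ h (t • u) + k := by
    refine le_trans (le_of_eq ?_) (norm_add_le _ _)
    congr 1
    simp only [map_smul]
    module
  linarith

/-- A nonzero lattice vector in the `-1`-eigenspace exists; discreteness prevents halving it
indefinitely inside the lattice. -/
theorem exists_isHalfLatticeVector (hΓ : IsBieberbach Γ) : ∃ v, IsHalfLatticeVector Γ v := by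
  by_contra! hno
  obtain ⟨w, hw, hne⟩ := hA.exists_apply_ne hΓ
  set u := w - A w
  have hu : u ∈ translationLattice Γ :=
    (translationLattice Γ).sub_mem hw (hA.apply_mem_translationLattice hw)
  have hu0 : u ≠ 0 := sub_ne_zero.2 hne.symm
  have hAu : A u = -u := by simp [u, map_sub, hA.apply_apply]
  have hpow : ∀ k : ℕ, ((1 / 2 : ℝ) ^ k) • u ∈ translationLattice Γ := by
    intro k
    induction k with
    | zero => simpa using hu
    | succ k ih =>
      by_contra hmem
      refine hno (((1 / 2 : ℝ) ^ (k + 1)) • u) ⟨?_, hmem, ?_⟩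
      · have : (2 : ℝ) • ((1 / 2 : ℝ) ^ (k + 1)) • u = ((1 / 2 : ℝ) ^ k) • u := by
          rw [smul_smul]; congr 1; ring
        rwa [this]
      · rw [hA.forall_inner_eq_zero_iff, map_smul, hAu, smul_neg]
  obtain ⟨ε, hε, hsmall⟩ := hΓ.exists_eps_translationLattice
  obtain ⟨k, hk⟩ := exists_pow_lt_of_lt_one (div_pos hε (norm_pos_iff.2 hu0))
    (by norm_num : (1 / 2 : ℝ) < 1)
  have := hsmall _ (hpow k) (by
    rw [norm_smul, norm_pow, Real.norm_of_nonneg (by norm_num)]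
    exact (lt_div_iff₀ (norm_pos_iff.2 hu0)).1 hk)
  rw [smul_eq_zero] at this
  exact this.elim (by positivity) hu0

end IsHolonomyInvolution

end Holonomy

/-! ### Isometries inducing free involutions of the quotient -/

section Doubling

variable {n : ℕ} {Γ : Subgroup (Isom n)}

/-- An isometry `τ` of Euclidean space that induces a fixed-point-free involution of `Eⁿ / Γ`. -/
structure InducesFreeInvolution (Γ : Subgroup (Isom n)) (τ : Isom n) : Prop where
  conj_mem : ∀ γ ∈ Γ, τ * γ * τ⁻¹ ∈ Γ
  mul_self_mem : τ * τ ∈ Γ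
  ne : ∀ γ ∈ Γ, ∀ x, τ x ≠ γ x

theorem IsHalfLatticeVector.inducesFreeInvolution {A : Euc n ≃ₗᵢ[ℝ] Euc n}
    (hA : IsHolonomyInvolution Γ A) (hΓ : IsBieberbach Γ) {v : Euc n}
    (hv : IsHalfLatticeVector Γ v) : InducesFreeInvolution Γ (trans v) := by
  have hAv : A v = -v := hA.forall_inner_eq_zero_iff.1 hv.orthogonal
  have h2v : trans v * trans v = trans ((2 : ℝ) • v) := by
    ext1 x
    change v + (v + x) = (2 : ℝ) • v + x
    rw [two_smul, add_assoc]
  refine ⟨fun γ hγ => ?_, h2v ▸ hv.two_smul_mem, fun γ hγ x hx => ?_⟩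
  · rcases hA.linearPart_eq hγ with hlin | hlin
    · have h : trans v * γ * (trans v)⁻¹ = γ := by
        rw [mul_inv_eq_iff_eq_mul, eq_trans_of_linearPart_eq_one hlin]
        ext1 x
        exact add_left_comm _ _ _
      rwa [h]
    · have h : trans v * γ * (trans v)⁻¹ = trans ((2 : ℝ) • v) * γ := by
        rw [mul_inv_eq_iff_eq_mul]
        ext1 x
        change v + γ x = (2 : ℝ) • v + γ (v + x)
        rw [isom_apply_eq γ x, isom_apply_eq γ (v + x), map_add, hlin, hAv, two_smul]
        abel
      rw [h]
      exact Γ.mul_mem hv.two_smul_mem hγ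
  · rw [trans_apply, isom_apply_eq γ] at hx
    rcases hA.linearPart_eq hγ with hlin | hlin
    · rw [hlin] at hx
      have : v = γ 0 := by
        rw [add_comm] at hx
        exact add_left_cancel hx
      apply hv.notMem
      change trans v ∈ Γ
      rwa [this, ← eq_trans_of_linearPart_eq_one hlin]
    · -- the translation part of `γ` has no component fixed by `A`, so half of it is a fixed point
      rw [hlin] at hx
      have hc : A (γ 0) = -(γ 0) := by
        have h0 : γ 0 = v + x - A x := by rw [hx]; abel
        rw [h0, map_sub, map_add, hA.apply_apply, hAv]
        abel
      have hne : γ ≠ 1 := by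
        rintro rfl
        exact hA.ne_one (by rw [← hlin, map_one])
      refine hΓ.free γ hγ hne ((1 / 2 : ℝ) • γ 0) ?_
      rw [isom_apply_eq γ, hlin, map_smul, hc]
      module

theorem InducesFreeInvolution.exists_isAdmissible {τ : Isom n}
    (hτ : InducesFreeInvolution Γ τ) :
    ∃ f : OrbitSpace Γ → OrbitSpace Γ, (∀ x, f (proj Γ x) = proj Γ (τ x)) ∧
      IsAdmissible Γ f := by
  let f : OrbitSpace Γ → OrbitSpace Γ :=
    Quotient.lift (fun x => proj Γ (τ x)) fun x y hxy => by
      obtain ⟨γ, rfl⟩ := hxy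
      refine proj_eq_proj_iff.2 ⟨_, hτ.conj_mem γ γ.2, ?_⟩
      change τ (γ.1 (τ.symm (τ y))) = τ (γ.1 y)
      rw [τ.symm_apply_apply]
  have hf : ∀ x, f (proj Γ x) = proj Γ (τ x) := fun _ => rfl
  have hinv : Function.Involutive f := fun a => by
    obtain ⟨x, rfl⟩ := proj_surjective a
    rw [hf, hf]
    exact proj_eq_proj_iff.2 ⟨_, hτ.mul_self_mem, rfl⟩
  refine ⟨f, hf, fun a b => ?_, hinv, fun a => ?_⟩
  · unfold orbitDist
    congr 1
    ext r
    constructor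
    · rintro ⟨x, y, hx, hy, rfl⟩
      refine ⟨τ.symm x, τ.symm y, hinv.injective ?_, hinv.injective ?_, (τ.symm.dist_map x y).symm⟩
      · rw [hf, τ.apply_symm_apply, hx]
      · rw [hf, τ.apply_symm_apply, hy]
    · rintro ⟨x, y, rfl, rfl, rfl⟩
      exact ⟨τ x, τ y, rfl, rfl, (τ.dist_map x y).symm⟩
  · obtain ⟨x, rfl⟩ := proj_surjective a
    rw [hf, Ne, proj_eq_proj_iff]
    rintro ⟨γ, hγ, h⟩
    exact hτ.ne γ hγ x h.symm

end Doubling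

/-! ### Manifolds with Euclidean coordinate changes -/

section EuclideanAtlas

variable {m : ℕ} [NeZero m] {W : Type} [TopologicalSpace W]
  [ChartedSpace (EuclideanHalfSpace m) W]

/-- A preferred chart at any point of `W` differs from any other one, near any point of their
common domain, by an isometry of Euclidean space. -/
def HasEuclideanCharts (m : ℕ) [NeZero m] (W : Type) [TopologicalSpace W]
    [ChartedSpace (EuclideanHalfSpace m) W] : Prop :=
  ∀ p q z : W, z ∈ (extChartAt (𝓡∂ m) p).source → z ∈ (extChartAt (𝓡∂ m) q).source →
    ∃ A : Isom m, extChartAt (𝓡∂ m) q ∘ (extChartAt (𝓡∂ m) p).symm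
      =ᶠ[𝓝[Set.range (𝓡∂ m)] (extChartAt (𝓡∂ m) p z)] A

theorem contDiff_isom {k : ℕ} (A : Isom k) : ContDiff ℝ ∞ A :=
  A.toContinuousAffineEquiv.toContinuousAffineMap.contDiff

theorem hasFDerivAt_isom {k : ℕ} (A : Isom k) (x : Euc k) :
    HasFDerivAt A ((linearPart k A).toContinuousLinearEquiv : Euc k →L[ℝ] Euc k) x := by
  have h : (A : Euc k → Euc k) = fun y => linearPart k A y + A 0 := funext (isom_apply_eq A)
  rw [h]
  exact ((linearPart k A).toContinuousLinearEquiv.hasFDerivAt).add_const _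

variable [IsManifold (𝓡∂ m) ∞ W]

namespace HasEuclideanCharts

theorem inner_tangentCoordChange (hW : HasEuclideanCharts m W)
    {p q z : W} (hp : z ∈ (extChartAt (𝓡∂ m) p).source)
    (hq : z ∈ (extChartAt (𝓡∂ m) q).source) (u v : Euc m) :
    inner ℝ (tangentCoordChange (𝓡∂ m) p q z u) (tangentCoordChange (𝓡∂ m) p q z v) =
      inner ℝ u v := by
  obtain ⟨A, hA⟩ := hW p q z hp hq
  have hmem : extChartAt (𝓡∂ m) p z ∈ Set.range (𝓡∂ m) :=
    extChartAt_target_subset_range p ((extChartAt (𝓡∂ m) p).map_source hp)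
  have h : HasFDerivWithinAt (extChartAt (𝓡∂ m) q ∘ (extChartAt (𝓡∂ m) p).symm)
      ((linearPart m A).toContinuousLinearEquiv : Euc m →L[ℝ] Euc m) (Set.range (𝓡∂ m))
      (extChartAt (𝓡∂ m) p z) :=
    (hasFDerivAt_isom A _).hasFDerivWithinAt.congr_of_eventuallyEq hA (hA.self_of_nhdsWithin hmem)
  rw [tangentCoordChange_def, h.fderivWithin ((𝓡∂ m).uniqueDiffOn _ hmem)]
  exact (linearPart m A).inner_map_map u v

/-- The trivializations of the tangent bundle given by the preferred charts are fibrewise isometric.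
Both the smoothness of the metric and its form in the charts come from this. -/
theorem inner_symmL (hW : HasEuclideanCharts m W)
    {p z : W} (hz : z ∈ (chartAt (EuclideanHalfSpace m) p).source)
    (u v : Euc m) :
    inner (E := Euc m) ℝ
      ((trivializationAt (Euc m) (TangentSpace (𝓡∂ m)) p).symmL ℝ z u)
      ((trivializationAt (Euc m) (TangentSpace (𝓡∂ m)) p).symmL ℝ z v) = inner ℝ u v := by
  rw [TangentBundle.symmL_trivializationAt_eq_core hz]
  exact hW.inner_tangentCoordChange (by simpa using hz) (by simp) u v

/-- The inner product of Euclidean space as a continuous bilinear form. -/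
def innerForm (m : ℕ) : Euc m →L[ℝ] Euc m →L[ℝ] ℝ := innerSL ℝ (E := Euc m)

/-- The inner product of the model space, on the tangent space at a point of `W`. -/
def tangentForm (z : W) :
    TangentSpace (𝓡∂ m) z →L[ℝ] TangentSpace (𝓡∂ m) z →L[ℝ] ℝ :=
  innerForm m

/-- The Riemannian metric which in every preferred chart is the Euclidean one. As the tangent
space at a point is identified with the model space by the preferred chart at that point,
it is given by the inner product of the model space. -/
def metric (hW : HasEuclideanCharts m W) : Metric m W where
  inner := tangentForm
  symm _ v w := real_inner_comm (F := Euc m) w v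
  pos _ _ hv := (real_inner_self_pos (F := Euc m)).2 hv
  isVonNBounded _ := by
    change Bornology.IsVonNBounded ℝ {v : Euc m | inner ℝ v v < 1}
    have : Metric.ball (0 : Euc m) 1 = {v : Euc m | inner ℝ v v < 1} := by
      ext v
      simp
    rw [← this]
    exact NormedSpace.isVonNBounded_ball ℝ _ 1
  contMDiff := by
    intro p
    rw [Bundle.contMDiffAt_section]
    refine (contMDiffAt_const (c := innerForm m)).congr_of_eventuallyEq ?_
    filter_upwards [chart_source_mem_nhds (EuclideanHalfSpace m) p] with z hz
    ext1 u
    ext1 v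
    refine (inCoordinates_apply_eq₂ hz hz (Set.mem_univ _)).trans ?_
    have h := hW.inner_symmL hz u v
    rw [Bundle.Trivialization.symmL_apply _ hz, Bundle.Trivialization.symmL_apply _ hz] at h
    simp only [Bundle.Trivial.fiberBundle_trivializationAt',
      Bundle.Trivial.linearMapAt_trivialization, LinearMap.id_coe, id_eq]
    exact h

theorem coordMetric_eq (hW : HasEuclideanCharts m W)
    {p : W} {y : Euc m} (hy : y ∈ (extChartAt (𝓡∂ m) p).target)
    (u v : Euc m) : coordMetric hW.metric p y u v = inner ℝ u v := by
  have hz : (extChartAt (𝓡∂ m) p).symm y ∈ (chartAt (EuclideanHalfSpace m) p).source := by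
    rw [← extChartAt_source (𝓡∂ m)]
    exact (extChartAt (𝓡∂ m) p).map_target hy
  have hyz : extChartAt (𝓡∂ m) p ((extChartAt (𝓡∂ m) p).symm y) = y :=
    (extChartAt (𝓡∂ m) p).right_inv hy
  have h := hW.inner_symmL hz u v
  rw [TangentBundle.symmL_trivializationAt hz, hyz] at h
  exact h

theorem isFlat (hW : HasEuclideanCharts m W) : IsFlat hW.metric := by
  intro p
  refine ⟨(chartAt (EuclideanHalfSpace m) p).source, extChartAt (𝓡∂ m) p,
    (chartAt _ p).open_source, mem_chart_source _ p, ?_, contMDiffOn_extChartAt, ?_⟩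
  · rw [← extChartAt_source (𝓡∂ m)]
    exact (extChartAt (𝓡∂ m) p).injOn
  · intro q hq u v
    rw [← TangentBundle.continuousLinearMapAt_trivializationAt hq,
      TangentBundle.continuousLinearMapAt_trivializationAt_eq_core hq]
    exact hW.inner_tangentCoordChange (mem_extChartAt_source q) (by simpa using hq) u v

/-- The metric has constant coefficients in the preferred charts, so the Levi-Civita connection
has vanishing Christoffel symbols in them. -/
theorem koszul_eq_zero (hW : HasEuclideanCharts m W)
    (p : W) (u v w : Euc m) : koszul hW.metric p u v w = 0 := by
  have h (u v w : Euc m) : fderivWithin ℝ (fun y => coordMetric hW.metric p y u v)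
      (Set.range (𝓡∂ m)) (extChartAt (𝓡∂ m) p p) w = 0 := by
    have heq : (fun y => coordMetric hW.metric p y u v)
        =ᶠ[𝓝[Set.range (𝓡∂ m)] (extChartAt (𝓡∂ m) p p)] fun _ => inner ℝ u v := by
      filter_upwards [extChartAt_target_mem_nhdsWithin (I := 𝓡∂ m) p] with y hy
      exact hW.coordMetric_eq hy u v
    rw [heq.fderivWithin_eq (hW.coordMetric_eq (mem_extChartAt_target p) u v)]
    simp
  rw [koszul, h, h, h, add_zero, sub_zero]

theorem hasTotallyGeodesicBoundary (hW : HasEuclideanCharts m W) :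
    HasTotallyGeodesicBoundary hW.metric :=
  fun p _ u v w _ _ _ => hW.koszul_eq_zero p u v w

end HasEuclideanCharts

end EuclideanAtlas

/-! ### Flat manifolds from local homeomorphisms of the half-space -/

section Parametrization

variable {m : ℕ} [NeZero m] {W : Type} [TopologicalSpace W]

/-- A parametrization of `W` by an open subset `O` of the half-space: a local homeomorphism of `O`
onto `W` whose fibres are related by isometries of Euclidean space, compatibly with the
parametrization near each point. Nothing is required of `π` outside `O` apart from what the last
condition says about the points `z'`. -/
structure IsEuclideanParametrization (π : EuclideanHalfSpace m → W)
    (O : Set (EuclideanHalfSpace m)) : Prop where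
  isOpen : IsOpen O
  isLocalHomeomorphOn : IsLocalHomeomorphOn π O
  surjOn : ∀ p, ∃ x ∈ O, π x = p
  exists_isom : ∀ x ∈ O, ∀ y ∈ O, π x = π y → ∃ A : Isom m, A x.1 = y.1 ∧
    ∀ᶠ z in 𝓝 x, ∃ z' : EuclideanHalfSpace m, z'.1 = A z.1 ∧ π z' = π z

namespace IsEuclideanParametrization

variable {π : EuclideanHalfSpace m → W} {O : Set (EuclideanHalfSpace m)}

theorem exists_localInverse (h : IsEuclideanParametrization π O) (p : W) :
    ∃ e : OpenPartialHomeomorph (EuclideanHalfSpace m) W, e.source ⊆ O ∧ ⇑e = π ∧ p ∈ e.target := by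
  obtain ⟨x, hx, rfl⟩ := h.surjOn p
  obtain ⟨e, hxe, he⟩ := h.isLocalHomeomorphOn x hx
  refine ⟨e.restrOpen O h.isOpen, fun y hy => ?_, he.symm, ?_⟩
  · rw [e.restrOpen_source] at hy
    exact hy.2
  · have : x ∈ (e.restrOpen O h.isOpen).source := by
      rw [e.restrOpen_source]
      exact ⟨hxe, hx⟩
    rw [congrFun he x]
    exact (e.restrOpen O h.isOpen).map_source this

/-- A restriction of `π` to an open subset of `O` which is a homeomorphism onto a neighbourhood
of `p`. -/
def param (h : IsEuclideanParametrization π O) (p : W) :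
    OpenPartialHomeomorph (EuclideanHalfSpace m) W :=
  (h.exists_localInverse p).choose

theorem param_source_subset (h : IsEuclideanParametrization π O) (p : W) :
    (h.param p).source ⊆ O :=
  (h.exists_localInverse p).choose_spec.1

theorem coe_param (h : IsEuclideanParametrization π O) (p : W) : ⇑(h.param p) = π :=
  (h.exists_localInverse p).choose_spec.2.1

theorem param_apply (h : IsEuclideanParametrization π O) (p : W) (x : EuclideanHalfSpace m) :
    h.param p x = π x :=
  congrFun (h.coe_param p) x

theorem mem_param_target (h : IsEuclideanParametrization π O) (p : W) : p ∈ (h.param p).target :=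
  (h.exists_localInverse p).choose_spec.2.2

theorem param_symm_mem (h : IsEuclideanParametrization π O) {p z : W}
    (hz : z ∈ (h.param p).target) : (h.param p).symm z ∈ O :=
  h.param_source_subset p ((h.param p).map_target hz)

theorem apply_param_symm (h : IsEuclideanParametrization π O) {p z : W}
    (hz : z ∈ (h.param p).target) : π ((h.param p).symm z) = z := by
  rw [← h.param_apply p]
  exact (h.param p).right_inv hz

/-- The coordinates of `π w` in any of the charts depend on `w` through an isometry, near any point
of `O`. The isometry relating `x` to the other preimage of `π x` is the coordinate change: the
point `z'` with `π z' = π w` that it provides lies in the source of `param q`, where `π` is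
injective. -/
theorem exists_isom_param_symm (h : IsEuclideanParametrization π O)
    (q : W) {x : EuclideanHalfSpace m} (hx : x ∈ O) (hq : π x ∈ (h.param q).target) :
    ∃ A : Isom m, ∀ᶠ w in 𝓝 x, ((h.param q).symm (π w)).1 = A w.1 := by
  obtain ⟨A, hA, hev⟩ := h.exists_isom x hx _ (h.param_symm_mem hq) (h.apply_param_symm hq).symm
  refine ⟨A, ?_⟩
  obtain ⟨V, hV, hVs⟩ := isOpen_induced_iff.1 (h.param q).open_source
  have hxV : A x.1 ∈ V := by
    rw [hA]
    change (h.param q).symm (π x) ∈ Subtype.val ⁻¹' V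
    rw [hVs]
    exact (h.param q).map_target hq
  have hcont : ContinuousAt (fun w : EuclideanHalfSpace m => A w.1) x :=
    (A.continuous.comp continuous_subtype_val).continuousAt
  filter_upwards [hev, hcont.preimage_mem_nhds (hV.mem_nhds hxV)] with w hw hwV
  obtain ⟨z', hz', hπ⟩ := hw
  have hz's : z' ∈ (h.param q).source := by
    rw [← hVs]
    change z'.1 ∈ V
    rw [hz']
    exact hwV
  rw [← hπ, ← hz', ← h.param_apply q, (h.param q).left_inv hz's]

/-- The atlas of `W` formed by local inverses of the parametrization. -/
abbrev chartedSpace (h : IsEuclideanParametrization π O) :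
    ChartedSpace (EuclideanHalfSpace m) W where
  atlas := Set.range fun p => (h.param p).symm
  chartAt p := (h.param p).symm
  mem_chart_source p := h.mem_param_target p
  chart_mem_atlas p := ⟨p, rfl⟩

theorem isManifold (h : IsEuclideanParametrization π O) :
    letI := h.chartedSpace
    IsManifold (𝓡∂ m) ∞ W := by
  let := h.chartedSpace
  refine isManifold_of_contDiffOn _ _ _ ?_
  rintro _ _ ⟨p, rfl⟩ ⟨q, rfl⟩ _ ⟨hx, x, rfl⟩
  rw [Set.mem_preimage, ModelWithCorners.left_inv] at hx
  have hxp : x ∈ (h.param p).source := hx.1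
  have hxq : h.param p x ∈ (h.param q).target := hx.2
  rw [h.param_apply] at hxq
  obtain ⟨A, hA⟩ := h.exists_isom_param_symm q (h.param_source_subset p hxp) hxq
  have hev : (𝓡∂ m) ∘ ((h.param p).symm.symm ≫ₕ (h.param q).symm) ∘ (𝓡∂ m).symm
      =ᶠ[𝓝[Set.range (𝓡∂ m)] ((𝓡∂ m) x)] A := by
    rw [← (𝓡∂ m).map_nhds_eq]
    refine Filter.eventually_map.2 ?_
    filter_upwards [hA] with w hw
    refine Eq.trans ?_ hw
    rw [← h.param_apply p]
    simp only [Function.comp_apply, ModelWithCorners.left_inv]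
    rfl
  exact (((contDiff_isom A).contDiffAt.contDiffWithinAt.congr_of_eventuallyEq hev
    (hev.self_of_nhdsWithin ⟨x, rfl⟩))).mono Set.inter_subset_right

theorem hasEuclideanCharts (h : IsEuclideanParametrization π O) :
    letI := h.chartedSpace
    HasEuclideanCharts m W := by
  let := h.chartedSpace
  intro p q z hp hq
  rw [extChartAt_source] at hp hq
  have hp' : z ∈ (h.param p).target := hp
  have hq' : z ∈ (h.param q).target := hq
  obtain ⟨A, hA⟩ := h.exists_isom_param_symm q (h.param_symm_mem hp')
    (by rwa [h.apply_param_symm hp'])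
  refine ⟨A, ?_⟩
  change _ =ᶠ[𝓝[Set.range (𝓡∂ m)] ((𝓡∂ m) ((h.param p).symm z))] A
  rw [← (𝓡∂ m).map_nhds_eq]
  refine Filter.eventually_map.2 ?_
  filter_upwards [hA] with w hw
  refine Eq.trans ?_ hw
  rw [← h.param_apply p]
  change (𝓡∂ m) ((h.param q).symm (h.param p ((𝓡∂ m).symm ((𝓡∂ m) w)))) = _
  rw [ModelWithCorners.left_inv]
  rfl

theorem mem_boundary_iff (h : IsEuclideanParametrization π O) (p : W) :
    letI := h.chartedSpace
    p ∈ (𝓡∂ m).boundary W ↔ ((h.param p).symm p).1 0 = 0 := by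
  let := h.chartedSpace
  rw [ModelWithCorners.boundary, Set.mem_ofPred_eq, ModelWithCorners.isBoundaryPoint_iff,
    frontier_range_modelWithCornersEuclideanHalfSpace]
  exact eq_comm

/-- A map into `W` which lifts through the parametrization to an affine isometric embedding `B`
with values in `O` is smooth. -/
theorem contMDiff_of_lift (h : IsEuclideanParametrization π O) {n : ℕ}
    (B : Euc n →ᵃⁱ[ℝ] Euc m) (l : Euc n → EuclideanHalfSpace m) (hl : ∀ x, (l x).1 = B x)
    (hlO : ∀ x, l x ∈ O) {F : Euc n → W} (hF : ∀ x, F x = π (l x)) :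
    letI := h.chartedSpace
    ContMDiff 𝓘(ℝ, Euc n) (𝓡∂ m) ∞ F ∧
    ∀ x u v : Euc n, inner (E := Euc m) ℝ
      (mfderiv 𝓘(ℝ, Euc n) (𝓡∂ m) F x u)
      (mfderiv 𝓘(ℝ, Euc n) (𝓡∂ m) F x v) = inner ℝ u v := by
  obtain rfl : F = fun x => π (l x) := funext hF
  let := h.chartedSpace
  have hlcont : Continuous l :=
    Continuous.subtype_mk (B.continuous.congr fun x => (hl x).symm) _
  have hcont : Continuous fun x => π (l x) := by
    refine continuous_iff_continuousAt.2 fun x => ?_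
    obtain ⟨e, hxe, he⟩ := h.isLocalHomeomorphOn _ (hlO x)
    rw [he]
    exact (e.continuousAt hxe).comp hlcont.continuousAt
  have hloc (x : Euc n) : ∃ A : Isom m,
      writtenInExtChartAt 𝓘(ℝ, Euc n) (𝓡∂ m) x (fun x => π (l x)) =ᶠ[𝓝 x] fun y => A (B y) := by
    obtain ⟨A, hA⟩ := h.exists_isom_param_symm (π (l x)) (hlO x) (h.mem_param_target _)
    refine ⟨A, ?_⟩
    filter_upwards [hlcont.continuousAt.eventually hA] with y hy
    rw [← hl, ← hy]
    rfl
  have hBd : ContDiff ℝ ∞ B := B.toContinuousAffineMap.contDiff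
  have hsmooth : ContMDiff 𝓘(ℝ, Euc n) (𝓡∂ m) ∞ (fun x => π (l x)) := by
    intro x
    obtain ⟨A, hA⟩ := hloc x
    rw [contMDiffAt_iff]
    refine ⟨hcont.continuousAt, ContDiffAt.contDiffWithinAt ?_⟩
    exact (((contDiff_isom A).comp hBd).contDiffAt).congr_of_eventuallyEq hA
  refine ⟨hsmooth, fun x u v => ?_⟩
  obtain ⟨A, hA⟩ := hloc x
  have hd : HasFDerivAt (fun y => A (B y))
      (((linearPart m A).toContinuousLinearEquiv : Euc m →L[ℝ] Euc m).comp
        B.linearIsometry.toContinuousLinearMap) x := by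
    refine (hasFDerivAt_isom A _).comp x ?_
    have : (B : Euc n → Euc m) = fun y => B.linearIsometry y + B 0 := by
      funext y
      simpa using B.map_vadd 0 y
    rw [this]
    exact B.linearIsometry.toContinuousLinearMap.hasFDerivAt.add_const _
  have hmd : mfderiv 𝓘(ℝ, Euc n) (𝓡∂ m) (fun x => π (l x)) x =
      ((linearPart m A).toContinuousLinearEquiv : Euc m →L[ℝ] Euc m).comp
        B.linearIsometry.toContinuousLinearMap := by
    refine HasMFDerivAt.mfderiv ⟨hcont.continuousAt, ?_⟩
    exact (hd.congr_of_eventuallyEq hA).hasFDerivWithinAt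
  rw [hmd]
  exact ((linearPart m A).inner_map_map _ _).trans (B.linearIsometry.inner_map_map u v)

end IsEuclideanParametrization

end Parametrization

/-! ### Coordinates on Euclidean space adapted to a hyperplane -/

section Coordinates

variable {n : ℕ}

/-- The point of Euclidean space with `0`-th coordinate `t` and remaining coordinates `x`. -/
def consE (t : ℝ) (x : Euc n) : Euc (n + 1) := WithLp.toLp 2 (Fin.cons t x.ofLp)

/-- The coordinates other than the `0`-th one. -/
def tailE (x : Euc (n + 1)) : Euc n := WithLp.toLp 2 fun i => x i.succ

@[simp] theorem consE_zero (t : ℝ) (x : Euc n) : consE t x 0 = t := rfl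

@[simp] theorem consE_succ (t : ℝ) (x : Euc n) (i : Fin n) : consE t x i.succ = x i := rfl

@[simp] theorem tailE_consE (t : ℝ) (x : Euc n) : tailE (consE t x) = x := rfl

@[simp] theorem consE_tailE (x : Euc (n + 1)) : consE (x 0) (tailE x) = x := by
  ext i
  induction i using Fin.cases <;> rfl

theorem continuous_tailE : Continuous (tailE : Euc (n + 1) → Euc n) := by
  unfold tailE
  fun_prop

theorem continuous_consE : Continuous fun p : ℝ × Euc n => consE p.1 p.2 := by
  refine (PiLp.continuous_toLp 2 _).comp (continuous_pi fun i => ?_)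
  induction i using Fin.cases with
  | zero => exact continuous_fst
  | succ i => exact (by fun_prop : Continuous fun p : ℝ × Euc n => p.2 i)

theorem dist_sq_eq_add (x y : Euc (n + 1)) :
    dist x y ^ 2 = dist (x 0) (y 0) ^ 2 + dist (tailE x) (tailE y) ^ 2 := by
  rw [EuclideanSpace.dist_eq, EuclideanSpace.dist_eq, Real.sq_sqrt (by positivity),
    Real.sq_sqrt (by positivity), Fin.sum_univ_succ]
  rfl

/-- The isometry acting by `e` on the `0`-th coordinate and by `δ` on the remaining ones. -/
def prodIsom (e : ℝ ≃ᵢ ℝ) (δ : Isom n) : Isom (n + 1) :=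
  IsometryEquiv.toRealAffineIsometryEquiv
    { toFun := fun x => consE (e (x 0)) (δ (tailE x))
      invFun := fun x => consE (e.symm (x 0)) (δ.symm (tailE x))
      left_inv := fun x => by simp
      right_inv := fun x => by simp
      isometry_toFun := Isometry.of_dist_eq fun x y => by
        rw [← sq_eq_sq₀ dist_nonneg dist_nonneg, dist_sq_eq_add, dist_sq_eq_add x y]
        simp [e.isometry.dist_eq] }

theorem prodIsom_apply (e : ℝ ≃ᵢ ℝ) (δ : Isom n) (x : Euc (n + 1)) :
    prodIsom e δ x = consE (e (x 0)) (δ (tailE x)) := rfl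

/-- The embedding of Euclidean space as the hyperplane where the `0`-th coordinate vanishes. -/
def hyperplaneEmbedding (n : ℕ) : Euc n →ₗᵢ[ℝ] Euc (n + 1) where
  toFun := consE 0
  map_add' x y := by
    ext i
    induction i using Fin.cases <;> simp
  map_smul' c x := by
    ext i
    induction i using Fin.cases <;> simp
  norm_map' x := by
    have h0 : consE 0 (0 : Euc n) = 0 := by
      ext i
      induction i using Fin.cases <;> simp
    have h := dist_sq_eq_add (consE 0 x) (consE 0 0)
    rw [tailE_consE, tailE_consE, h0, dist_zero_right, dist_zero_right] at h
    rw [← sq_eq_sq₀ (norm_nonneg _) (norm_nonneg _)]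
    simpa using h

end Coordinates

/-! ### The twisted interval bundle over the quotient by a free involution -/

section Doubling

variable {n : ℕ} {Γ : Subgroup (Isom n)} {τ : Isom n}

namespace InducesFreeInvolution

theorem notMem (hτ : InducesFreeInvolution Γ τ) : τ ∉ Γ := fun h => hτ.ne τ h 0 rfl

theorem inv_conj_mem (hτ : InducesFreeInvolution Γ τ) {γ : Isom n} (hγ : γ ∈ Γ) :
    τ⁻¹ * γ * τ ∈ Γ := by
  have h : τ⁻¹ * γ * τ = (τ * τ)⁻¹ * (τ * γ * τ⁻¹) * (τ * τ) := by group
  rw [h]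
  exact Γ.mul_mem (Γ.mul_mem (Γ.inv_mem hτ.mul_self_mem) (hτ.conj_mem γ hγ)) hτ.mul_self_mem

/-- The group generated by `Γ` and `τ`, which contains `Γ` with index two. -/
def extension (hτ : InducesFreeInvolution Γ τ) : Subgroup (Isom n) where
  carrier := {δ | δ ∈ Γ ∨ τ * δ ∈ Γ}
  one_mem' := Or.inl Γ.one_mem
  mul_mem' {a b} ha hb := by
    rcases ha with ha | ha <;> rcases hb with hb | hb
    · exact Or.inl (Γ.mul_mem ha hb)
    · right
      have h : τ * (a * b) = (τ * a * τ⁻¹) * (τ * b) := by group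
      rw [h]
      exact Γ.mul_mem (hτ.conj_mem a ha) hb
    · right
      rw [← mul_assoc]
      exact Γ.mul_mem ha hb
    · left
      have h : a * b = (τ⁻¹ * (τ * a) * τ) * (τ * τ)⁻¹ * (τ * b) := by group
      rw [h]
      exact Γ.mul_mem (Γ.mul_mem (hτ.inv_conj_mem ha) (Γ.inv_mem hτ.mul_self_mem)) hb
  inv_mem' {a} ha := by
    rcases ha with ha | ha
    · exact Or.inl (Γ.inv_mem ha)
    · right
      have h : τ * a⁻¹ = (τ * (τ * a)⁻¹ * τ⁻¹) * (τ * τ) := by group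
      rw [h]
      exact Γ.mul_mem (hτ.conj_mem _ (Γ.inv_mem ha)) hτ.mul_self_mem

theorem mul_mem_of_notMem (hτ : InducesFreeInvolution Γ τ) (δ : hτ.extension)
    (h : (δ : Isom n) ∉ Γ) : τ * (δ : Isom n) ∈ Γ :=
  δ.2.resolve_left h

theorem notMem_of_mul_mem (hτ : InducesFreeInvolution Γ τ) {δ : Isom n} (h : τ * δ ∈ Γ) :
    δ ∉ Γ := fun h' => hτ.notMem (by simpa using Γ.mul_mem h (Γ.inv_mem h'))

theorem mul_mem_iff (hτ : InducesFreeInvolution Γ τ) (a b : hτ.extension) :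
    (a * b : Isom n) ∈ Γ ↔ ((a : Isom n) ∈ Γ ↔ (b : Isom n) ∈ Γ) := by
  by_cases ha : (a : Isom n) ∈ Γ
  · simp [ha, Γ.mul_mem_cancel_left ha]
  · by_cases hb : (b : Isom n) ∈ Γ
    · simp [hb, ha, Γ.mul_mem_cancel_right hb]
    · simp only [ha, hb, iff_self, iff_true]
      have h : (a * b : Isom n) =
          (τ⁻¹ * (τ * a) * τ) * (τ * τ)⁻¹ * (τ * b) := by group
      rw [h]
      exact Γ.mul_mem (Γ.mul_mem (hτ.inv_conj_mem (hτ.mul_mem_of_notMem a ha))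
        (Γ.inv_mem hτ.mul_self_mem)) (hτ.mul_mem_of_notMem b hb)

end InducesFreeInvolution

/-- The slab `Eⁿ × [-1, 1]`. -/
def Slab (n : ℕ) : Type := Euc n × Set.Icc (-1 : ℝ) 1

namespace Slab

instance : TopologicalSpace (Slab n) :=
  inferInstanceAs (TopologicalSpace (Euc n × Set.Icc (-1 : ℝ) 1))

instance : T2Space (Slab n) := inferInstanceAs (T2Space (Euc n × Set.Icc (-1 : ℝ) 1))

instance : LocallyCompactSpace (Slab n) :=
  inferInstanceAs (LocallyCompactSpace (Euc n × Set.Icc (-1 : ℝ) 1))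

instance : ConnectedSpace (Slab n) :=
  haveI : ConnectedSpace (Set.Icc (-1 : ℝ) 1) :=
    isConnected_iff_connectedSpace.1 (isConnected_Icc (by norm_num))
  inferInstanceAs (ConnectedSpace (Euc n × Set.Icc (-1 : ℝ) 1))

/-- The reflection of the interval `[-1, 1]` in its midpoint. -/
def flip (t : Set.Icc (-1 : ℝ) 1) : Set.Icc (-1 : ℝ) 1 :=
  ⟨-t, by linarith [t.2.2], by linarith [t.2.1]⟩

@[simp] theorem coe_flip (t : Set.Icc (-1 : ℝ) 1) : (flip t : ℝ) = -t := rfl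

@[simp] theorem flip_flip (t : Set.Icc (-1 : ℝ) 1) : flip (flip t) = t := Subtype.ext (neg_neg _)

/-- The point `(x, 1)` of the slab. -/
def endPoint (x : Euc n) : Slab n := (x, ⟨1, by norm_num, le_rfl⟩)

theorem continuous_endPoint : Continuous (endPoint : Euc n → Slab n) :=
  continuous_id.prodMk continuous_const

theorem continuous_flip : Continuous flip :=
  Continuous.subtype_mk (continuous_subtype_val.neg) _

open scoped Classical in
/-- The action on the slab of the group generated by `Γ` and `τ`: elements outside `Γ` reflect the
interval. -/
instance (hτ : InducesFreeInvolution Γ τ) : MulAction hτ.extension (Slab n) where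
  smul δ p := (δ.1 p.1, if δ.1 ∈ Γ then p.2 else flip p.2)
  one_smul p := by
    refine Prod.ext rfl ?_
    exact if_pos Γ.one_mem
  mul_smul a b p := by
    refine Prod.ext rfl ?_
    change (if (a * b : Isom n) ∈ Γ then p.2 else flip p.2) =
      if a.1 ∈ Γ then (if b.1 ∈ Γ then p.2 else flip p.2)
      else flip (if b.1 ∈ Γ then p.2 else flip p.2)
    rw [hτ.mul_mem_iff]
    by_cases ha : a.1 ∈ Γ <;> by_cases hb : b.1 ∈ Γ <;> simp [ha, hb]

variable {hτ : InducesFreeInvolution Γ τ}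

theorem smul_of_mem {δ : hτ.extension} (h : δ.1 ∈ Γ) (p : Slab n) :
    δ • p = (δ.1 p.1, p.2) := Prod.ext rfl (if_pos h)

theorem smul_of_notMem {δ : hτ.extension} (h : δ.1 ∉ Γ) (p : Slab n) :
    δ • p = (δ.1 p.1, flip p.2) := Prod.ext rfl (if_neg h)

instance : ContinuousConstSMul hτ.extension (Slab n) where
  continuous_const_smul δ := by
    by_cases h : δ.1 ∈ Γ
    · simp only [smul_of_mem h]
      exact (δ.1.continuous.comp continuous_fst).prodMk continuous_snd
    · simp only [smul_of_notMem h]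
      exact (δ.1.continuous.comp continuous_fst).prodMk (continuous_flip.comp continuous_snd)

theorem properlyDiscontinuousSMul (hΓ : IsBieberbach Γ) :
    ProperlyDiscontinuousSMul hτ.extension (Slab n) where
  finite_disjoint_inter_image {K L} hK hL := by
    have hK' := (hK.image (f := fun p : Slab n => p.1) continuous_fst).isBounded
    have hL' := (hL.image (f := fun p : Slab n => p.1) continuous_fst).isBounded
    have hfin := ((hΓ.finite_inter 1 hK' hL').union (hΓ.finite_inter τ hK' hL')).preimage
      (f := fun δ : hτ.extension => δ.1) Subtype.val_injective.injOn
    refine hfin.subset ?_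
    rintro δ ⟨_, ⟨p, hp, rfl⟩, hpL⟩
    have hmeet : ∃ x ∈ (fun p : Slab n => p.1) '' K, δ.1 x ∈ (fun p : Slab n => p.1) '' L :=
      ⟨p.1, ⟨p, hp, rfl⟩, δ • p, hpL, rfl⟩
    rcases δ.2 with h | h
    · exact Or.inl ⟨by rwa [one_mul], hmeet⟩
    · exact Or.inr ⟨h, hmeet⟩

/-- The action on the slab is free. -/
theorem isCancelSMul (hΓ : IsBieberbach Γ) : IsCancelSMul hτ.extension (Slab n) := by
  rw [isCancelSMul_iff_eq_one_of_smul_eq]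
  intro δ p hδ
  have hfix : δ.1 p.1 = p.1 := congrArg Prod.fst hδ
  rcases δ.2 with h | h
  · by_contra hne
    exact hΓ.free _ h (fun h1 => hne (Subtype.ext h1)) _ hfix
  · exact absurd (congrArg τ hfix).symm (hτ.ne _ h p.1)

end Slab

/-- The quotient `W` of the slab: the interval bundle associated with the double covering of
`(Eⁿ / Γ) / τ` by `Eⁿ / Γ`. -/
abbrev IntervalBundle (hτ : InducesFreeInvolution Γ τ) : Type :=
  MulAction.orbitRel.Quotient hτ.extension (Slab n)

/-- A Bieberbach group has a bounded fundamental set. -/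
theorem IsBieberbach.exists_forall_norm_le (hΓ : IsBieberbach Γ) :
    ∃ R : ℝ, ∀ x : Euc n, ∃ γ ∈ Γ, ‖γ x‖ ≤ R := by
  have := hΓ.cocompact
  have : ContinuousConstSMul Γ (Euc n) := ⟨fun γ => γ.1.continuous⟩
  have hopen : IsOpenMap (proj Γ) := isOpenMap_quotient_mk'_mul
  obtain ⟨k, hk⟩ := isCompact_univ.elim_directed_cover
    (fun k : ℕ => proj Γ '' Metric.ball 0 k) (fun k => hopen _ Metric.isOpen_ball)
    (fun a _ => by
      obtain ⟨x, rfl⟩ := proj_surjective a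
      obtain ⟨k, hk⟩ := exists_nat_gt ‖x‖
      exact Set.mem_iUnion.2 ⟨k, x, mem_ball_zero_iff.2 hk, rfl⟩)
    (directed_of_isDirected_le fun i j hij => Set.image_mono
      (Metric.ball_subset_ball (Nat.cast_le.2 hij)))
  refine ⟨k, fun x => ?_⟩
  obtain ⟨y, hy, hxy⟩ := hk (Set.mem_univ (proj Γ x))
  obtain ⟨γ, hγ, rfl⟩ := proj_eq_proj_iff.1 hxy
  exact ⟨γ, hγ, (mem_ball_zero_iff.1 hy).le⟩

namespace IntervalBundle

variable {hτ : InducesFreeInvolution Γ τ}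

/-- The class in the interval bundle of a point of the slab. -/
def mk (hτ : InducesFreeInvolution Γ τ) (p : Slab n) : IntervalBundle hτ := Quotient.mk _ p

theorem continuous_mk : Continuous (mk hτ) := continuous_quot_mk

theorem mk_surjective : Function.Surjective (mk hτ) := Quotient.mk_surjective

theorem mk_eq_mk_iff {p q : Slab n} : mk hτ p = mk hτ q ↔ ∃ δ : hτ.extension, δ • p = q := by
  rw [eq_comm, mk, mk, Quotient.eq, MulAction.orbitRel_apply, MulAction.mem_orbit_iff]

theorem isLocalHomeomorph_mk (hΓ : IsBieberbach Γ) : IsLocalHomeomorph (mk hτ) :=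
  haveI := Slab.properlyDiscontinuousSMul (hτ := hτ) hΓ
  haveI := Slab.isCancelSMul (hτ := hτ) hΓ
  isQuotientCoveringMap_quotientMk_of_properlyDiscontinuousSMul.isCoveringMap.isLocalHomeomorph

theorem t2Space (hΓ : IsBieberbach Γ) : T2Space (IntervalBundle hτ) :=
  haveI := Slab.properlyDiscontinuousSMul (hτ := hτ) hΓ
  t2Space_of_properlyDiscontinuousSMul_of_t2Space

theorem compactSpace (hΓ : IsBieberbach Γ) : CompactSpace (IntervalBundle hτ) := by
  obtain ⟨R, hR⟩ := hΓ.exists_forall_norm_le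
  have hK : IsCompact (Metric.closedBall (0 : Euc n) R ×ˢ (Set.univ : Set (Set.Icc (-1 : ℝ) 1))) :=
    (isCompact_closedBall _ _).prod isCompact_univ
  refine ⟨(hK.image (f := mk hτ) continuous_mk).of_isClosed_subset isClosed_univ fun p _ => ?_⟩
  obtain ⟨⟨x, t⟩, rfl⟩ := mk_surjective p
  obtain ⟨γ, hγ, hγR⟩ := hR x
  refine ⟨(γ x, t), ⟨mem_closedBall_zero_iff.2 hγR, Set.mem_univ _⟩, Eq.symm ?_⟩
  exact mk_eq_mk_iff.2 ⟨⟨γ, Or.inl hγ⟩, Slab.smul_of_mem hγ _⟩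

instance connectedSpace : ConnectedSpace (IntervalBundle hτ) :=
  inferInstanceAs (ConnectedSpace (Quotient (MulAction.orbitRel hτ.extension (Slab n))))

/-- The coordinates on the slab given by the half-space, shifted so that the boundary of the
half-space corresponds to the end `1` of the interval; points too far from it are sent to the other
end. -/
def slabCoord (z : EuclideanHalfSpace (n + 1)) : Slab n :=
  (tailE z.1, Set.projIcc (-1) 1 (by norm_num) (1 - z.1 0))

/-- The part of the half-space that corresponds to the slab without its end `-1`. -/
def coordDomain (n : ℕ) : Set (EuclideanHalfSpace (n + 1)) := {z | z.1 0 < 2}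

theorem isOpen_coordDomain : IsOpen (coordDomain n) :=
  isOpen_lt (by fun_prop) continuous_const

theorem slabCoord_snd {z : EuclideanHalfSpace (n + 1)} (hz : z.1 0 ≤ 2) :
    ((slabCoord z).2 : ℝ) = 1 - z.1 0 := by
  have h0 := z.2
  rw [slabCoord, Set.projIcc_of_mem (by norm_num) ⟨by linarith, by linarith⟩]

/-- `slabCoord` as a homeomorphism from its domain onto the slab without its end `-1`. -/
def slabCoordHomeo (n : ℕ) : OpenPartialHomeomorph (EuclideanHalfSpace (n + 1)) (Slab n) where
  toFun := slabCoord
  invFun p := ⟨consE (1 - p.2) p.1, by rw [consE_zero]; linarith [p.2.2.2]⟩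
  source := coordDomain n
  target := {p | -1 < (p.2 : ℝ)}
  map_source' z hz := by
    have hz' : z.1 0 < 2 := hz
    rw [Set.mem_ofPred_eq, slabCoord_snd hz'.le]
    linarith
  map_target' p hp := by
    have hp' : -1 < (p.2 : ℝ) := hp
    change 1 - (p.2 : ℝ) < 2
    linarith
  left_inv' z hz := by
    have hz' : z.1 0 < 2 := hz
    refine Subtype.ext ?_
    change consE (1 - ((slabCoord z).2 : ℝ)) (tailE z.1) = z.1
    rw [slabCoord_snd hz'.le, sub_sub_cancel, consE_tailE]
  right_inv' p hp := by
    refine Prod.ext rfl (Subtype.ext ?_)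
    have hp' := p.2.2.1
    rw [slabCoord_snd (by change 1 - (p.2 : ℝ) ≤ 2; linarith)]
    exact sub_sub_cancel _ _
  open_source := isOpen_coordDomain
  open_target := isOpen_lt continuous_const (continuous_subtype_val.comp continuous_snd)
  continuousOn_toFun := by
    refine Continuous.continuousOn ?_
    exact (continuous_tailE.comp continuous_subtype_val).prodMk
      (continuous_projIcc.comp (by fun_prop))
  continuousOn_invFun := by
    refine Continuous.continuousOn (Continuous.subtype_mk ?_ _)
    exact continuous_consE.comp ((continuous_const.sub
      (continuous_subtype_val.comp continuous_snd)).prodMk continuous_fst)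

/-- The interval bundle is parametrized by the half-space: up to the action of `τ`, every point of
the slab lies on the side of the end `1` of the interval. -/
theorem isEuclideanParametrization (hΓ : IsBieberbach Γ) :
    IsEuclideanParametrization (fun z => mk hτ (slabCoord z)) (coordDomain n) where
  isOpen := isOpen_coordDomain
  isLocalHomeomorphOn :=
    (isLocalHomeomorph_mk hΓ).isLocalHomeomorphOn.comp (t := Set.univ)
      (fun z hz => ⟨slabCoordHomeo n, hz, rfl⟩) (Set.mapsTo_univ _ _)
  surjOn p := by
    have key : ∀ q : Slab n, -1 < (q.2 : ℝ) →
        ∃ z ∈ coordDomain n, mk hτ (slabCoord z) = mk hτ q := fun q hq =>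
      ⟨(slabCoordHomeo n).symm q, (slabCoordHomeo n).map_target hq,
        congrArg (mk hτ) ((slabCoordHomeo n).right_inv hq)⟩
    obtain ⟨q, rfl⟩ := mk_surjective p
    by_cases hq : -1 < (q.2 : ℝ)
    · exact key q hq
    · -- `τ⁻¹` moves the end `-1` to the end `1`
      have hmem : τ * τ⁻¹ ∈ Γ := by rw [mul_inv_cancel]; exact Γ.one_mem
      let δ : hτ.extension := ⟨τ⁻¹, Or.inr hmem⟩
      obtain ⟨z, hz, h⟩ := key (δ • q) (by
        rw [Slab.smul_of_notMem (hτ.notMem_of_mul_mem hmem)]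
        change -1 < -(q.2 : ℝ)
        linarith)
      exact ⟨z, hz, h.trans (mk_eq_mk_iff.2 ⟨δ, rfl⟩).symm⟩
  exists_isom x hx y hy hxy := by
    obtain ⟨δ, hδ⟩ := mk_eq_mk_iff.1 hxy
    have hx' : x.1 0 < 2 := hx
    have hy' : y.1 0 < 2 := hy
    have hfst : δ.1 (tailE x.1) = tailE y.1 := congrArg Prod.fst hδ
    -- in the half-space the reflection `t ↦ -t` of the interval reads `s ↦ 2 - s`, as `t = 1 - s`
    by_cases h : δ.1 ∈ Γ
    · refine ⟨prodIsom (IsometryEquiv.refl ℝ) δ.1, ?_, ?_⟩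
      · rw [Slab.smul_of_mem h] at hδ
        have h2 : ((slabCoord x).2 : ℝ) = (slabCoord y).2 := congrArg (fun p => (p.2 : ℝ)) hδ
        rw [slabCoord_snd hx'.le, slabCoord_snd hy'.le] at h2
        have h3 : x.1 0 = y.1 0 := by linarith
        rw [prodIsom_apply, hfst]
        change consE (x.1 0) _ = _
        rw [h3, consE_tailE]
      · filter_upwards [isOpen_coordDomain.mem_nhds hx] with z hz
        refine ⟨⟨prodIsom (IsometryEquiv.refl ℝ) δ.1 z.1, z.2⟩, rfl, Eq.symm ?_⟩
        refine mk_eq_mk_iff.2 ⟨δ, ?_⟩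
        rw [Slab.smul_of_mem h]
        rfl
    · refine ⟨prodIsom (IsometryEquiv.subLeft 2) δ.1, ?_, ?_⟩
      · rw [Slab.smul_of_notMem h] at hδ
        have h2 : -((slabCoord x).2 : ℝ) = (slabCoord y).2 := congrArg (fun p => (p.2 : ℝ)) hδ
        rw [slabCoord_snd hx'.le, slabCoord_snd hy'.le] at h2
        have h3 : 2 - x.1 0 = y.1 0 := by linarith
        rw [prodIsom_apply, hfst, IsometryEquiv.subLeft_apply, h3, consE_tailE]
      · filter_upwards [isOpen_coordDomain.mem_nhds hx] with z hz
        have hz' : z.1 0 < 2 := hz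
        have hz0 := z.2
        refine ⟨⟨prodIsom (IsometryEquiv.subLeft 2) δ.1 z.1, by
          change 0 ≤ 2 - z.1 0; linarith⟩, rfl, Eq.symm ?_⟩
        refine mk_eq_mk_iff.2 ⟨δ, ?_⟩
        rw [Slab.smul_of_notMem h]
        refine Prod.ext rfl (Subtype.ext ?_)
        rw [slabCoord_snd (by change 2 - z.1 0 ≤ 2; linarith)]
        change -((slabCoord z).2 : ℝ) = 1 - (2 - z.1 0)
        rw [slabCoord_snd hz'.le]
        ring

/-- The image of the end `1` of the interval is the whole boundary. -/
theorem mem_boundary_iff (hΓ : IsBieberbach Γ) (p : IntervalBundle hτ) :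
    letI := (isEuclideanParametrization (hτ := hτ) hΓ).chartedSpace
    p ∈ (𝓡∂ (n + 1)).boundary (IntervalBundle hτ) ↔ ∃ x : Euc n, mk hτ (Slab.endPoint x) = p := by
  have h := isEuclideanParametrization (hτ := hτ) hΓ
  rw [h.mem_boundary_iff]
  set z := (h.param p).symm p
  have hz : z.1 0 < 2 := h.param_symm_mem (h.mem_param_target p)
  have hzp : mk hτ (slabCoord z) = p := h.apply_param_symm (h.mem_param_target p)
  constructor
  · intro h0
    refine ⟨tailE z.1, ?_⟩
    rw [← hzp]
    congr 1
    refine Prod.ext rfl (Subtype.ext ?_)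
    rw [slabCoord_snd hz.le, h0, sub_zero]
    rfl
  · rintro ⟨x, hx⟩
    rw [← hzp] at hx
    obtain ⟨δ, hδ⟩ := mk_eq_mk_iff.1 hx
    by_cases hmem : δ.1 ∈ Γ
    · rw [Slab.smul_of_mem hmem] at hδ
      have h2 : (1 : ℝ) = (slabCoord z).2 := congrArg (fun p => (p.2 : ℝ)) hδ
      rw [slabCoord_snd hz.le] at h2
      linarith
    · -- the end `-1` of the interval would have coordinate `2`, outside the domain
      rw [Slab.smul_of_notMem hmem] at hδ
      have h2 : -(1 : ℝ) = (slabCoord z).2 := congrArg (fun p => (p.2 : ℝ)) hδ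
      rw [slabCoord_snd hz.le] at h2
      linarith

/-- The map from `Eⁿ / Γ` to the interval bundle onto the end `1` of the interval. -/
def endMap (hτ : InducesFreeInvolution Γ τ) : OrbitSpace Γ → IntervalBundle hτ :=
  Quotient.lift (fun x => mk hτ (Slab.endPoint x)) fun x y hxy => by
    obtain ⟨γ, rfl⟩ := hxy
    exact (mk_eq_mk_iff.2 ⟨⟨γ.1, Or.inl γ.2⟩, Slab.smul_of_mem (δ := ⟨γ.1, Or.inl γ.2⟩) γ.2
      (Slab.endPoint y)⟩).symm

theorem continuous_endMap : Continuous (endMap hτ) :=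
  (continuous_mk.comp Slab.continuous_endPoint).quotient_lift _

theorem endMap_injective : Function.Injective (endMap hτ) := by
  intro a b hab
  obtain ⟨x, rfl⟩ := proj_surjective a
  obtain ⟨y, rfl⟩ := proj_surjective b
  obtain ⟨δ, hδ⟩ := mk_eq_mk_iff.1
    (show mk hτ (Slab.endPoint x) = mk hτ (Slab.endPoint y) from hab)
  by_cases hmem : δ.1 ∈ Γ
  · exact (proj_eq_proj_iff.2 ⟨δ.1, hmem, congrArg Prod.fst hδ⟩).symm
  · rw [Slab.smul_of_notMem hmem] at hδ
    have h2 : -(1 : ℝ) = 1 := congrArg (fun p : Slab n => (p.2 : ℝ)) hδ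
    norm_num at h2

end IntervalBundle

theorem InducesFreeInvolution.isGeodesicBoundary (hτ : InducesFreeInvolution Γ τ)
    (hΓ : IsBieberbach Γ) : IsGeodesicBoundary Γ := by
  have h := IntervalBundle.isEuclideanParametrization (hτ := hτ) hΓ
  let := h.chartedSpace
  have hmfd := h.isManifold
  have hT2 := IntervalBundle.t2Space (hτ := hτ) hΓ
  have := hΓ.cocompact
  let f : OrbitSpace Γ → (𝓡∂ (n + 1)).boundary (IntervalBundle hτ) := fun a =>
    ⟨IntervalBundle.endMap hτ a, by
      obtain ⟨x, rfl⟩ := proj_surjective a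
      exact (IntervalBundle.mem_boundary_iff hΓ _).2 ⟨x, rfl⟩⟩
  have hf : Function.Bijective f := by
    refine ⟨fun a b hab => IntervalBundle.endMap_injective (congrArg Subtype.val hab), fun p => ?_⟩
    obtain ⟨x, hx⟩ := (IntervalBundle.mem_boundary_iff hΓ p.1).1 p.2
    exact ⟨proj Γ x, Subtype.ext hx⟩
  have hfc : Continuous (Equiv.ofBijective f hf) := IntervalBundle.continuous_endMap.subtype_mk _
  refine ⟨IntervalBundle hτ, inferInstance, h.chartedSpace, hmfd, h.hasEuclideanCharts.metric,
    hT2, IntervalBundle.compactSpace hΓ, inferInstance, h.hasEuclideanCharts.isFlat,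
    h.hasEuclideanCharts.hasTotallyGeodesicBoundary, hfc.homeoOfEquivCompactToT2, ?_⟩
  have hlift (x : Euc n) : IntervalBundle.mk hτ (Slab.endPoint x) =
      IntervalBundle.mk hτ
        (IntervalBundle.slabCoord ⟨hyperplaneEmbedding n x, le_refl (0 : ℝ)⟩) := by
    congr 1
    refine Prod.ext rfl (Subtype.ext ?_)
    rw [IntervalBundle.slabCoord_snd (show (0 : ℝ) ≤ 2 by norm_num)]
    exact (sub_zero 1).symm
  have hmain := h.contMDiff_of_lift (hyperplaneEmbedding n).toAffineIsometry
    (fun x => ⟨hyperplaneEmbedding n x, le_refl (0 : ℝ)⟩) (fun _ => rfl)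
    (fun _ => show (0 : ℝ) < 2 by norm_num) hlift
  exact hmain

end Doubling

end FlatBoundary

end

theorem mainTheorem3 (n : ℕ) (Γ : Subgroup (FlatBoundary.Isom n))
    (hΓ : FlatBoundary.IsBieberbach Γ)
    (hol : Nonempty (FlatBoundary.holonomyGroup Γ ≃* Multiplicative (ZMod 2))) :
    (∃ v : FlatBoundary.Euc n, FlatBoundary.IsHalfLatticeVector Γ v) ∧
    (∀ v : FlatBoundary.Euc n, FlatBoundary.IsHalfLatticeVector Γ v →
      ∃ f : FlatBoundary.OrbitSpace Γ → FlatBoundary.OrbitSpace Γ,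
        (∀ x : FlatBoundary.Euc n,
          f (FlatBoundary.proj Γ x) = FlatBoundary.proj Γ (FlatBoundary.trans v x)) ∧
        FlatBoundary.IsAdmissible Γ f) ∧
    FlatBoundary.IsGeodesicBoundary Γ := by
  obtain ⟨A, hA⟩ := FlatBoundary.exists_isHolonomyInvolution hol
  obtain ⟨v, hv⟩ := hA.exists_isHalfLatticeVector hΓ
  exact ⟨⟨v, hv⟩, fun w hw => (hw.inducesFreeInvolution hA hΓ).exists_isAdmissible,
    (hv.inducesFreeInvolution hA hΓ).isGeodesicBoundary hΓ⟩
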